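/- Graphs are in the sense of Serre: a set of vertices, a set of arcs, origin and terminus maps $o,t$, and an involution $a\mapsto\bar a$ on arcs with $o(a)=t(\bar a)$; an arc with $a=\bar a$ is called self-reverse. Trees are non-empty. A graph of group actions $\mathcal G$ consists of a non-empty connected graph $\Delta$; a permutation group $G(v)$ on a non-empty set $X(v)$ for each vertex $v$; a permutation group $H(a)$ on a non-empty set $Y(a)$ for each arc $a$, with $(H(\bar a),Y(\bar a))=(H(a),Y(a))$; for each arc $a$ an injection $\Phi_a\colon Y(a)\to X(t(a))$ inducing an isomorphism from $H(a)$ onto the permutation group that the setwise stabiliser of $\Phi_a(Y(a))$ in $G(t(a))$ induces on $\Phi_a(Y(a))$; and for each self-reverse arc $a$ a permutation $h_a$ of $Y(a)$ with $h_aH(a)h_a^{-1}=H(a)$ and $h_a^2\in H(a)$. An $a$-adhesion set is a translate $\gamma\Phi_a(Y(a))$, an $a$-adhesion map is a map $\gamma\Phi_a$, and, for $a$ self-reverse, a twisted $a$-adhesion map is a map $\gamma\Phi_ah_a$, where $\gamma\in G(t(a))$. A scaffolding $(\Sigma,\sim,\pi,p)$ for $\mathcal G$ consists of a graph $\Sigma$,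 an equivalence relation $\sim$ on its vertices, extended to arcs by $a\sim b$ iff $o(a)\sim o(b)$ and $t(a)\sim t(b)$, such that $T_\Sigma=\Sigma/{\sim}$ is a tree and no arc of $\Sigma$ joins equivalent vertices; a graph morphism $\pi\colon T_\Sigma\to\Delta$; and a map $p$ on the vertices and arcs of $\Sigma$ such that, writing $[x]$ for the class of $x$ and $[\![x]\!]$ for the corresponding element of $T_\Sigma$: (1) $p$ restricts to bijections $[v]\to X(\pi[\![v]\!])$ and $[a]\to Y(\pi[\![a]\!])$ for all vertices $v$ and arcs $a$, and $p(\bar a)=p(a)$; (2) let $\Psi_{[\![a]\!]}\colon Y(\pi[\![a]\!])\to X(t(\pi[\![a]\!]))$ be the map with $\Psi_{[\![a]\!]}(p(b))=p(t(b))$ for all $b\in[a]$; if $\pi[\![a]\!]$ is not self-reverse then $\Psi_{[\![a]\!]}$ is a $\pi[\![a]\!]$-adhesion map, and if $\pi[\![a]\!]$ is self-reverse then one of $\Psi_{[\![a]\!]},\Psi_{[\![\bar a]\!]}$ is a $\pi[\![a]\!]$-adhesion map and the other is a twisted $\pi[\![a]\!]$-adhesion map; (3) for every vertex $[\![v]\!]$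 of $T_\Sigma$, every arc $b$ of $\Delta$ with $t(b)=\pi[\![v]\!]$ and every $b$-adhesion set $S$, there is exactly one arc $[\![a]\!]$ of $T_\Sigma$ with $\pi[\![a]\!]=b$, $t[\![a]\!]=[\![v]\!]$ and $\Psi_{[\![a]\!]}(p([a]))=S$. A scaffolding isomorphism $f\colon(\Sigma,\sim,\pi,p)\to(\Sigma',\sim',\pi',p')$ is a graph isomorphism $\Sigma\to\Sigma'$ with $x\sim y\iff f(x)\sim' f(y)$ and $\pi[\![x]\!]=\pi'[\![f(x)]\!]$ for all vertices or arcs $x,y$. It is acceptable if for every vertex $[\![v]\!]$ of $T_\Sigma$ the local map, i.e. the permutation $f_{[\![v]\!]}$ of $X(\pi[\![v]\!])$ with $f_{[\![v]\!]}(p(x))=p'(f(x))$ for all $x\in[v]$, lies in $G(\pi[\![v]\!])$. The universal group of $\mathcal G$ with respect to $\Sigma$ is the group of all acceptable scaffolding isomorphisms $\Sigma\to\Sigma$. **Theorem.** Let $\Sigma$ and $\Sigma'$ be scaffoldings for a graph of group actions $\mathcal G$, and let $U$ and $U'$ be the universal groups of $\mathcal G$ with respect to $\Sigma$ and $\Sigma'$.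 Then there is an acceptable scaffolding isomorphism $F\colon\Sigma\to\Sigma'$ such that $g\mapsto FgF^{-1}$ is a group isomorphism $\varphi\colon U\to U'$, and $(\varphi,F)$ is an isomorphism from the action of $U$ on $\Sigma$ to the action of $U'$ on $\Sigma'$, that is, $\varphi(g)(F(x))=F(g(x))$ for all $g\in U$ and all vertices and arcs $x$ of $\Sigma$. -/

import Mathlib

universe u v w x y z

/-- A graph in the sense of Serre: vertices, arcs, origin and terminus maps, and an involutive
reversal of arcs.  Loops, parallel arcs and self-reverse arcs are allowed. -/
structure SerreGraph where
  V : Type u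
  A : Type v
  o : A → V
  t : A → V
  rev : A → A
  rev_rev : ∀ a, rev (rev a) = a
  o_eq : ∀ a, o a = t (rev a)

namespace SerreGraph

theorem t_eq (Γ : SerreGraph) (a : Γ.A) : Γ.t a = Γ.o (Γ.rev a) := by
  rw [Γ.o_eq, Γ.rev_rev]

/-- The edges of a graph: an arc and its reverse form together an edge. -/
def Edge (Γ : SerreGraph) := Quot fun a b : Γ.A => b = Γ.rev a

/-- The edge formed by an arc and its reverse. -/
def edge (Γ : SerreGraph) (a : Γ.A) : Γ.Edge := Quot.mk _ a

/-- The underlying simple graph. -/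
def underlying (Γ : SerreGraph) : SimpleGraph Γ.V where
  Adj u v := u ≠ v ∧ ∃ a, Γ.o a = u ∧ Γ.t a = v
  symm := ⟨by
    rintro u v ⟨h, a, rfl, rfl⟩
    exact ⟨h.symm, Γ.rev a, (Γ.t_eq a).symm, (Γ.o_eq a).symm⟩⟩
  loopless := ⟨fun _ h => h.1 rfl⟩

/-- A graph is connected if it is non-empty and any two vertices are joined by a path. -/
def IsConnected (Γ : SerreGraph) : Prop := Γ.underlying.Connected

/-- A graph is simple if it has no loops and no two arcs share both origin and terminus. -/
def IsSimple (Γ : SerreGraph) : Prop :=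
  (∀ a, Γ.o a ≠ Γ.t a) ∧ Function.Injective fun a => (Γ.o a, Γ.t a)

/-- A tree is a simple connected (non-empty) graph without simple cycles of length at least 3. -/
def IsTree (Γ : SerreGraph) : Prop := Γ.IsSimple ∧ Γ.underlying.IsTree

/-- Graph morphisms. -/
structure Hom (Γ Δ : SerreGraph) where
  onV : Γ.V → Δ.V
  onA : Γ.A → Δ.A
  map_o : ∀ a, onV (Γ.o a) = Δ.o (onA a)
  map_t : ∀ a, onV (Γ.t a) = Δ.t (onA a)
  map_rev : ∀ a, onA (Γ.rev a) = Δ.rev (onA a)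

/-- Graph isomorphisms. -/
@[ext]
structure Iso (Γ Δ : SerreGraph) where
  onV : Γ.V ≃ Δ.V
  onA : Γ.A ≃ Δ.A
  map_o : ∀ a, onV (Γ.o a) = Δ.o (onA a)
  map_t : ∀ a, onV (Γ.t a) = Δ.t (onA a)
  map_rev : ∀ a, onA (Γ.rev a) = Δ.rev (onA a)

/-- The extension of an equivalence relation on the vertices to the arcs: two arcs are equivalent
if and only if their origins are equivalent and their termini are equivalent. -/
def arcSetoid (Γ : SerreGraph) (r : Setoid Γ.V) : Setoid Γ.A where
  r a b := r (Γ.o a) (Γ.o b) ∧ r (Γ.t a) (Γ.t b)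
  iseqv :=
    ⟨fun _ => ⟨r.refl _, r.refl _⟩, fun h => ⟨r.symm h.1, r.symm h.2⟩,
      fun h k => ⟨r.trans h.1 k.1, r.trans h.2 k.2⟩⟩

/-- The quotient of a graph by an equivalence relation on its vertices, extended to the arcs. -/
def quotient (Γ : SerreGraph) (r : Setoid Γ.V) : SerreGraph where
  V := Quotient r
  A := Quotient (Γ.arcSetoid r)
  o := Quotient.map Γ.o fun _ _ h => h.1
  t := Quotient.map Γ.t fun _ _ h => h.2
  rev := Quotient.map Γ.rev fun a b h => by
    constructor
    · show r _ _
      rw [← Γ.t_eq, ← Γ.t_eq]; exact h.2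
    · show r _ _
      rw [← Γ.o_eq, ← Γ.o_eq]; exact h.1
  rev_rev := by
    rintro ⟨a⟩
    exact congrArg (Quotient.mk _) (Γ.rev_rev a)
  o_eq := by
    rintro ⟨a⟩
    exact congrArg (Quotient.mk _) (Γ.o_eq a)

end SerreGraph

/-- The injection `Φ : Y → X` is an embedding of the permutation group `H` on `Y` into the
permutation group `G` on `X`: transport along `Φ` is an isomorphism from `H` onto the permutation
group that the setwise stabiliser in `G` of the image of `Φ` induces on that image. -/
structure IsActionEmbedding {Y X : Type*} (H : Subgroup (Equiv.Perm Y))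
    (G : Subgroup (Equiv.Perm X)) (Φ : Y → X) : Prop where
  injective : Function.Injective Φ
  exists_of_mem : ∀ h ∈ H, ∃ g ∈ G, ∀ y, g (Φ y) = Φ (h y)
  exists_of_stabilizes : ∀ g ∈ G, g '' Set.range Φ = Set.range Φ →
    ∃ h ∈ H, ∀ y, g (Φ y) = Φ (h y)

/-- A graph of group actions.  The actions `(H(a), Y(a))` at the arcs are indexed by the edges of
the base graph, which says that the actions at an arc and at its reverse are equal.  Permutation
groups are subgroups of the symmetric group. -/
structure GraphOfActions where
  base : SerreGraph.{u, v}
  connected : base.IsConnected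
  X : base.V → Type w
  X_nonempty : ∀ v, Nonempty (X v)
  G : ∀ v, Subgroup (Equiv.Perm (X v))
  Y : base.Edge → Type x
  Y_nonempty : ∀ e, Nonempty (Y e)
  H : ∀ e, Subgroup (Equiv.Perm (Y e))
  Φ : ∀ a, Y (base.edge a) → X (base.t a)
  embedding : ∀ a, IsActionEmbedding (H (base.edge a)) (G (base.t a)) (Φ a)
  /-- the inversion agents at the self-reverse arcs -/
  agent : ∀ a, base.rev a = a → Equiv.Perm (Y (base.edge a))
  agent_conj : ∀ a ha,
    (H (base.edge a)).map (MulAut.conj (agent a ha)).toMonoidHom = H (base.edge a)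
  agent_sq : ∀ a ha, agent a ha ^ 2 ∈ H (base.edge a)

namespace GraphOfActions

variable (𝒢 : GraphOfActions.{u, v, w, x})

/-- `a`-adhesion sets: the translates of the image of `Φ_a` under `G(t(a))`. -/
def IsAdhesionSet (a : 𝒢.base.A) (S : Set (𝒢.X (𝒢.base.t a))) : Prop :=
  ∃ γ ∈ 𝒢.G (𝒢.base.t a), S = γ '' Set.range (𝒢.Φ a)

/-- `a`-adhesion maps: the maps `γ Φ_a` with `γ ∈ G(t(a))`. -/
def IsAdhesionMap (a : 𝒢.base.A) (Ψ : 𝒢.Y (𝒢.base.edge a) → 𝒢.X (𝒢.base.t a)) : Prop :=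
  ∃ γ ∈ 𝒢.G (𝒢.base.t a), ∀ y, Ψ y = γ (𝒢.Φ a y)

/-- Twisted `a`-adhesion maps, for `a` self-reverse: the maps `γ Φ_a h_a` with `γ ∈ G(t(a))`. -/
def IsTwistedAdhesionMap (a : 𝒢.base.A) (Ψ : 𝒢.Y (𝒢.base.edge a) → 𝒢.X (𝒢.base.t a)) : Prop :=
  ∃ ha : 𝒢.base.rev a = a, ∃ γ ∈ 𝒢.G (𝒢.base.t a), ∀ y, Ψ y = γ (𝒢.Φ a (𝒢.agent a ha y))

/-- A scaffolding `(Σ, ∼, π, p)` for a graph of group actions.  The legal colouring `p` is given by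
its restrictions `pV` and `pA` to vertices and arcs, with values in the disjoint unions of the sets
`X(v)` and of the sets `Y(a)`. -/
structure Scaffolding where
  graph : SerreGraph.{y, z}
  r : Setoid graph.V
  isTree : (graph.quotient r).IsTree
  no_arc_in_bundle : ∀ a, ¬ r (graph.o a) (graph.t a)
  π : (graph.quotient r).Hom 𝒢.base
  pV : graph.V → Σ v, 𝒢.X v
  pA : graph.A → Σ e, 𝒢.Y e
  /-- `p` restricts to a bijection from each vertex bundle `[v]` onto `X(π⟦v⟧)` -/
  pV_bijOn : ∀ v : (graph.quotient r).V,
    Set.BijOn pV {x | Quotient.mk _ x = v} (Set.range (Sigma.mk (π.onV v)))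
  /-- `p` restricts to a bijection from each arc bundle `[a]` onto `Y(π⟦a⟧)` -/
  pA_bijOn : ∀ a : (graph.quotient r).A,
    Set.BijOn pA {b | Quotient.mk _ b = a} (Set.range (Sigma.mk (𝒢.base.edge (π.onA a))))
  pA_rev : ∀ b, pA (graph.rev b) = pA b
  /-- the map `Ψ_⟦a⟧`, which is determined by the next field -/
  Ψ : ∀ a : (graph.quotient r).A,
    𝒢.Y (𝒢.base.edge (π.onA a)) → 𝒢.X (𝒢.base.t (π.onA a))
  /-- `Ψ_⟦a⟧ (p b) = p (t b)` for every `b ∈ [a]` -/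
  Ψ_spec : ∀ (a : (graph.quotient r).A) (b : graph.A), Quotient.mk _ b = a →
    ∀ y, pA b = ⟨𝒢.base.edge (π.onA a), y⟩ → pV (graph.t b) = ⟨𝒢.base.t (π.onA a), Ψ a y⟩
  adhesion : ∀ a : (graph.quotient r).A, 𝒢.base.rev (π.onA a) ≠ π.onA a →
    𝒢.IsAdhesionMap (π.onA a) (Ψ a)
  adhesion_of_selfReverse : ∀ a : (graph.quotient r).A, 𝒢.base.rev (π.onA a) = π.onA a →
    (𝒢.IsAdhesionMap _ (Ψ a) ∧ 𝒢.IsTwistedAdhesionMap _ (Ψ ((graph.quotient r).rev a))) ∨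
    (𝒢.IsTwistedAdhesionMap _ (Ψ a) ∧ 𝒢.IsAdhesionMap _ (Ψ ((graph.quotient r).rev a)))
  existsUnique_arc : ∀ (v : (graph.quotient r).V) (b : 𝒢.base.A), 𝒢.base.t b = π.onV v →
    ∀ S : Set (𝒢.X (𝒢.base.t b)), 𝒢.IsAdhesionSet b S →
      ∃! a : (graph.quotient r).A, π.onA a = b ∧ (graph.quotient r).t a = v ∧
        (Sigma.mk _ '' Set.range (Ψ a) : Set (Σ v, 𝒢.X v)) = Sigma.mk _ '' S

variable {𝒢}

namespace Scaffolding

/-- The quotient graph `T_Σ = Σ/∼`. -/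
abbrev tree (S : 𝒢.Scaffolding) : SerreGraph := S.graph.quotient S.r

/-- The vertex `⟦x⟧` of `T_Σ`. -/
def bunV (S : 𝒢.Scaffolding) (x : S.graph.V) : S.tree.V := Quotient.mk S.r x

/-- The arc `⟦a⟧` of `T_Σ`. -/
def bunA (S : 𝒢.Scaffolding) (a : S.graph.A) : S.tree.A := Quotient.mk (S.graph.arcSetoid S.r) a

/-- Scaffolding isomorphisms: graph isomorphisms that preserve `∼` (on the vertices, and hence on
the arcs) and are compatible with the maps `π`. -/
@[ext]
structure Iso (S S' : 𝒢.Scaffolding) extends S.graph.Iso S'.graph where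
  rel_iff : ∀ x y, S.r x y ↔ S'.r (onV x) (onV y)
  π_onV : ∀ x, S.π.onV (S.bunV x) = S'.π.onV (S'.bunV (onV x))
  π_onA : ∀ a, S.π.onA (S.bunA a) = S'.π.onA (S'.bunA (onA a))

namespace Iso

variable {S S' S'' : 𝒢.Scaffolding}

/-- The permutation `g` of `X(π v)` is the local map of `f` at the vertex `v` of `T_Σ`:
`g (p x) = p' (f x)` for every `x` in the bundle of `v`. -/
def IsLocalMap (f : S.Iso S') (v : S.tree.V) (g : Equiv.Perm (𝒢.X (S.π.onV v))) : Prop :=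
  ∀ x, S.bunV x = v → ∀ z, S.pV x = ⟨S.π.onV v, z⟩ → S'.pV (f.onV x) = ⟨S.π.onV v, g z⟩

/-- A scaffolding isomorphism is acceptable if its local map at each vertex `v` of `T_Σ` is in
`G(π v)`. -/
def IsAcceptable (f : S.Iso S') : Prop :=
  ∀ v : S.tree.V, ∃ g ∈ 𝒢.G (S.π.onV v), f.IsLocalMap v g

/-- The identity. -/
def refl (S : 𝒢.Scaffolding) : S.Iso S where
  onV := Equiv.refl _
  onA := Equiv.refl _
  map_o _ := rfl
  map_t _ := rfl
  map_rev _ := rfl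
  rel_iff _ _ := Iff.rfl
  π_onV _ := rfl
  π_onA _ := rfl

/-- The inverse. -/
def symm (f : S.Iso S') : S'.Iso S where
  onV := f.onV.symm
  onA := f.onA.symm
  map_o a := by rw [Equiv.symm_apply_eq, f.map_o, Equiv.apply_symm_apply]
  map_t a := by rw [Equiv.symm_apply_eq, f.map_t, Equiv.apply_symm_apply]
  map_rev a := by rw [Equiv.symm_apply_eq, f.map_rev, Equiv.apply_symm_apply]
  rel_iff x y := by rw [f.rel_iff, Equiv.apply_symm_apply, Equiv.apply_symm_apply]
  π_onV x := by rw [f.π_onV, Equiv.apply_symm_apply]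
  π_onA x := by rw [f.π_onA, Equiv.apply_symm_apply]

/-- The composition `f' ∘ f`. -/
def comp (f' : S'.Iso S'') (f : S.Iso S') : S.Iso S'' where
  onV := f.onV.trans f'.onV
  onA := f.onA.trans f'.onA
  map_o a := (congrArg f'.onV (f.map_o a)).trans (f'.map_o _)
  map_t a := (congrArg f'.onV (f.map_t a)).trans (f'.map_t _)
  map_rev a := (congrArg f'.onA (f.map_rev a)).trans (f'.map_rev _)
  rel_iff x y := by rw [f.rel_iff, f'.rel_iff]; rfl
  π_onV x := by rw [f.π_onV, f'.π_onV]; rfl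
  π_onA x := by rw [f.π_onA, f'.π_onA]; rfl

theorem isAcceptable_refl (S : 𝒢.Scaffolding) : (refl S).IsAcceptable :=
  fun _ => ⟨1, one_mem _, fun _ _ _ h => h⟩

theorem exists_mem_transport {v w : 𝒢.base.V} (h : v = w) {g : Equiv.Perm (𝒢.X w)}
    (hg : g ∈ 𝒢.G w) : ∃ k ∈ 𝒢.G v, ∀ (y : 𝒢.X v) (z : 𝒢.X w),
      ((⟨v, y⟩ : Σ v, 𝒢.X v) = ⟨w, z⟩ ↔ (⟨v, k y⟩ : Σ v, 𝒢.X v) = ⟨w, g z⟩) := by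
  subst h
  exact ⟨g, hg, fun y z => by simp⟩

theorem exists_pV (S : 𝒢.Scaffolding) {x : S.graph.V} {w : 𝒢.base.V}
    (h : S.π.onV (S.bunV x) = w) : ∃ z : 𝒢.X w, S.pV x = ⟨w, z⟩ := by
  subst h
  obtain ⟨z, hz⟩ := (S.pV_bijOn (S.bunV x)).mapsTo (x := x) rfl
  exact ⟨z, hz.symm⟩

theorem bunV_onV_eq (f : S.Iso S') {x y : S.graph.V} (h : S.bunV x = S.bunV y) :
    S'.bunV (f.onV x) = S'.bunV (f.onV y) :=
  Quotient.sound ((f.rel_iff x y).1 (Quotient.exact h))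

theorem IsAcceptable.symm {f : S.Iso S'} (hf : f.IsAcceptable) : f.symm.IsAcceptable := by
  intro v
  induction v using Quotient.inductionOn with | _ x₀
  change ∃ g ∈ 𝒢.G (S'.π.onV (S'.bunV x₀)), f.symm.IsLocalMap (S'.bunV x₀) g
  obtain ⟨g, hg, hloc⟩ := hf (S.bunV (f.symm.onV x₀))
  have hv := f.symm.π_onV x₀
  obtain ⟨k, hk, hkt⟩ := exists_mem_transport hv (inv_mem hg)
  refine ⟨k, hk, fun x hx z hz => ?_⟩
  have hx' := f.symm.bunV_onV_eq hx
  obtain ⟨w, hw⟩ := exists_pV S (x := f.symm.onV x) (congrArg S.π.onV hx')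
  have h1 := hloc _ hx' w hw
  have e : f.onV (f.symm.onV x) = x := f.onV.apply_symm_apply x
  rw [e, hz] at h1
  have h2 := (hkt z (g w)).1 h1
  rw [hw, h2]
  simp

theorem IsAcceptable.comp {f' : S'.Iso S''} {f : S.Iso S'} (hf' : f'.IsAcceptable)
    (hf : f.IsAcceptable) : (f'.comp f).IsAcceptable := by
  intro v
  induction v using Quotient.inductionOn with | _ x₀
  change ∃ g ∈ 𝒢.G (S.π.onV (S.bunV x₀)), (f'.comp f).IsLocalMap (S.bunV x₀) g
  obtain ⟨g, hg, hloc⟩ := hf (S.bunV x₀)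
  obtain ⟨g', hg', hloc'⟩ := hf' (S'.bunV (f.onV x₀))
  have hv := f.π_onV x₀
  obtain ⟨k, hk, hkt⟩ := exists_mem_transport hv hg'
  refine ⟨k * g, mul_mem hk hg, fun x hx z hz => ?_⟩
  have h1 := hloc x hx z hz
  have hx' := f.bunV_onV_eq hx
  obtain ⟨w, hw⟩ := exists_pV S' (x := f.onV x) (congrArg S'.π.onV hx')
  have h2 := hloc' _ hx' w hw
  have h3 := (hkt (g z) w).1 (h1.symm.trans hw)
  exact h2.trans h3.symm

/-- The group `Aut_sc(Σ)` of scaffolding automorphisms. -/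
instance (S : 𝒢.Scaffolding) : Group (S.Iso S) where
  mul := comp
  one := refl S
  inv := symm
  mul_assoc _ _ _ := rfl
  one_mul _ := rfl
  mul_one _ := rfl
  inv_mul_cancel f := Iso.ext (f.onV.self_trans_symm) (f.onA.self_trans_symm)

/-- The action of `Aut_sc(Σ)` on the vertices of `Σ`. -/
instance (S : 𝒢.Scaffolding) : MulAction (S.Iso S) S.graph.V where
  smul f x := f.onV x
  one_smul _ := rfl
  mul_smul _ _ _ := rfl

/-- The action of `Aut_sc(Σ)` on the arcs of `Σ`. -/
instance (S : 𝒢.Scaffolding) : MulAction (S.Iso S) S.graph.A where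
  smul f a := f.onA a
  one_smul _ := rfl
  mul_smul _ _ _ := rfl

end Iso

/-- The universal group with respect to the scaffolding `S`: the group of all acceptable
scaffolding automorphisms. -/
def universalGroup (S : 𝒢.Scaffolding) : Subgroup (S.Iso S) where
  carrier := {f | f.IsAcceptable}
  mul_mem' hf hg := Iso.IsAcceptable.comp hf hg
  one_mem' := Iso.isAcceptable_refl S
  inv_mem' hf := Iso.IsAcceptable.symm hf

end Scaffolding

end GraphOfActions

/-- The group isomorphism `φ` and the bijection `F` form an isomorphism of group actions. -/
def IsActionIso {K L Z W : Type*} [Group K] [Group L] [MulAction K Z] [MulAction L W]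
    (φ : K ≃* L) (F : Z ≃ W) : Prop :=
  ∀ (k : K) (z : Z), φ k • F z = F (k • z)

/-! The isomorphism is built outwards along `T_Σ`. A root bundle is sent to a bundle of `Σ'` over
the same vertex of `Δ`, with the identity as local map. Suppose `v` is sent to `v'` with local map
`g`, and let `a` be a tree arc ending in `v`. Then `g` carries the adhesion set of `a` to an
adhesion set of the same arc of `Δ`, so axiom (3) provides exactly one matching arc `a'` into `v'`,
and the origin of `a` must go to the origin of `a'`.

The crux is `exists_matches`: `g` can be continued across `a`. Up to adhesion maps, `g` induces an
element of `H` on the edge; this stays in `H` after correction by the twists of both scaffoldings,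
because `h_a` normalises `H` and its square lies in `H`; hence it extends to an element of `G` at
the origin.

As trees have no cycles, these choices never conflict (`exists_section`), and the uniqueness in
axiom (3) makes the resulting map of trees locally, hence globally, bijective
(`bijective_of_local`). The local maps then define `F` on vertices, and arcs follow because an arc
of a scaffolding is determined by its ends. Working in the disjoint union of all `X(v)` avoids
transport along equalities in `Δ`. -/

/-! ### Recursive choices and local bijections on trees. -/

/-- The value at `v` is obtained by extending `s₀` along the unique path from `r` to `v`. Of two
adjacent vertices, one precedes the other on its path to the root, so `C` holds by construction in
one direction and by symmetry in the other. -/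
theorem SimpleGraph.IsTree.exists_section {V α : Type*} {T : SimpleGraph V} (hT : T.IsTree)
    (P : V → α → Prop) (C : V → V → α → α → Prop)
    (hsymm : ∀ v w s s', C v w s s' → C w v s' s)
    (hext : ∀ v w s, T.Adj v w → P v s → ∃ s', P w s' ∧ C v w s s')
    (r : V) (s₀ : α) (h₀ : P r s₀) :
    ∃ f : V → α, f r = s₀ ∧ (∀ v, P v (f v)) ∧ ∀ v w, T.Adj v w → C v w (f v) (f w) := by
  classical
  choose e he using hext
  let g : ∀ v, T.Walk v r → {s // P v s} := fun v p =>
    SimpleGraph.Walk.rec (motive := fun v w _ => P w s₀ → {s // P v s})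
      (fun h => ⟨s₀, h⟩)
      (fun {v w _} h _ ih hw => ⟨e w v (ih hw).1 h.symm (ih hw).2,
        (he w v (ih hw).1 h.symm (ih hw).2).1⟩) p h₀
  have hg : ∀ v w (h : T.Adj v w) (p : T.Walk w r),
      C w v (g w p) (g v (SimpleGraph.Walk.cons h p)) := fun v w h p =>
    (he w v (g w p).1 h.symm (g w p).2).2
  have hp : ∀ v, ∃ p : T.Walk v r, p.IsPath := fun v => by
    obtain ⟨p⟩ := hT.connected.preconnected v r
    exact ⟨p.bypass, p.bypass_isPath⟩
  choose p hp using hp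
  have huniq : ∀ v w (q q' : T.Walk v w), q.IsPath → q'.IsPath → q = q' := fun v w q q' h h' =>
    congrArg Subtype.val ((hT.isAcyclic.subsingleton_path v w).elim ⟨q, h⟩ ⟨q', h'⟩)
  have key : ∀ v w (h : T.Adj v w), v ∉ (p w).support → C w v (g w (p w)) (g v (p v)) := by
    intro v w h hv
    rw [huniq v r (p v) (SimpleGraph.Walk.cons h (p w)) (hp v) ((hp w).cons hv)]
    exact hg v w h _
  refine ⟨fun v => g v (p v), ?_, fun v => (g v (p v)).2, fun v w h => ?_⟩
  · show (g r (p r)).1 = s₀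
    rw [huniq r r (p r) SimpleGraph.Walk.nil (hp r) SimpleGraph.Walk.IsPath.nil]
  · by_cases hv : v ∈ (p w).support
    · refine key w v h.symm fun hw => ?_
      -- The part of the path of `w` up to `v` is the single edge, so the rest is the path of `v`,
      -- which therefore avoids `w`.
      have h1 := huniq _ _ _ _ ((hp w).takeUntil hv)
        (SimpleGraph.Walk.IsPath.cons SimpleGraph.Walk.IsPath.nil (u := w) (v := v) (h := h.symm)
          (by simpa using h.ne'))
      have h2 := huniq _ _ _ _ ((hp w).dropUntil hv) (hp v)
      have h3 := hp w
      rw [← (p w).take_spec hv, h1, h2] at h3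
      simp only [SimpleGraph.Walk.cons_append, SimpleGraph.Walk.nil_append,
        SimpleGraph.Walk.cons_isPath_iff] at h3
      exact h3.2 hw
    · exact hsymm _ _ _ _ (key v w h hv)

/-- A map between trees that is bijective on neighbourhoods is bijective. -/
theorem SimpleGraph.IsTree.bijective_of_local {V W : Type*} {T : SimpleGraph V}
    {T' : SimpleGraph W} (hT : T.IsTree) (hT' : T'.IsTree) (f : V → W)
    (hadj : ∀ v w, T.Adj v w → T'.Adj (f v) (f w))
    (hinj : ∀ v w₁ w₂, T.Adj v w₁ → T.Adj v w₂ → f w₁ = f w₂ → w₁ = w₂)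
    (hsurj : ∀ v w', T'.Adj (f v) w' → ∃ w, T.Adj v w ∧ f w = w') : Function.Bijective f := by
  obtain ⟨r⟩ := hT.connected.nonempty
  -- Lifting paths from `T'` to `T` gives a right inverse `s` of `f`; local injectivity, propagated
  -- from `r`, makes it a left inverse too.
  obtain ⟨s, hr, hs, hC⟩ := hT'.exists_section (fun w v => f v = w)
    (fun _ _ v v' => T.Adj v v') (fun _ _ _ _ h => h.symm)
    (fun w w' v h hv => by
      subst hv
      obtain ⟨v', h1, h2⟩ := hsurj v w' h
      exact ⟨v', h2, h1⟩) (f r) r rfl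
  have key : ∀ v, s (f v) = v := by
    intro v
    obtain ⟨q⟩ := hT.connected.preconnected v r
    induction q with
    | nil => exact hr
    | cons h q ih =>
      have ih := ih hr
      refine hinj _ _ _ ?_ h.symm (hs _)
      conv_lhs => rw [← ih]
      exact hC _ _ (hadj _ _ h.symm)
  exact ⟨Function.LeftInverse.injective key, fun w => ⟨s w, hs w⟩⟩

theorem SerreGraph.edge_rev (Γ : SerreGraph) (a : Γ.A) : Γ.edge (Γ.rev a) = Γ.edge a :=
  (Quot.sound (r := fun a b : Γ.A => b = Γ.rev a) rfl).symm

/-- An isomorphism of graphs without parallel arcs from a bijection of the vertices. -/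
theorem SerreGraph.exists_iso {Γ Δ : SerreGraph}
    (hΓ : Function.Injective fun a => (Γ.o a, Γ.t a))
    (hΔ : Function.Injective fun a => (Δ.o a, Δ.t a)) (e : Γ.V ≃ Δ.V)
    (P : Γ.A → Δ.A → Prop)
    (h₁ : ∀ a, ∃ b, Δ.o b = e (Γ.o a) ∧ Δ.t b = e (Γ.t a) ∧ P a b)
    (h₂ : ∀ b, ∃ a, Δ.o b = e (Γ.o a) ∧ Δ.t b = e (Γ.t a)) :
    ∃ f : Γ.Iso Δ, f.onV = e ∧ ∀ a, P a (f.onA a) := by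
  choose k ho ht hP using h₁
  -- Arcs are determined by their ends, so bijectivity and compatibility with reversal can be
  -- checked on ends.
  refine ⟨{ onV := e, onA := Equiv.ofBijective k ⟨fun a b h => hΓ ?_, fun b => ?_⟩,
            map_o := fun a => (ho a).symm, map_t := fun a => (ht a).symm,
            map_rev := fun a => hΔ ?_ }, rfl, hP⟩
  · refine Prod.ext (e.injective ?_) (e.injective ?_)
    · rw [← ho, ← ho, h]
    · rw [← ht, ← ht, h]
  · obtain ⟨a, h, h'⟩ := h₂ b
    exact ⟨a, hΔ (Prod.ext ((ho a).trans h.symm) ((ht a).trans h'.symm))⟩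
  · refine Prod.ext ?_ ?_
    · change Δ.o (k _) = Δ.o (Δ.rev (k a))
      rw [ho, ← Γ.t_eq, ← Δ.t_eq, ht]
    · change Δ.t (k _) = Δ.t (Δ.rev (k a))
      rw [ht, ← Γ.o_eq, ← Δ.o_eq, ho]

/-! ### Permutations of the colours, adhesion maps and twists. -/

namespace GraphOfActions

variable (𝒢 : GraphOfActions.{u, v, w, x})

/-- The permutations of the disjoint union of the sets `X(v)` that are in `G(v)` on each `X(v)`. -/
def totalGroup : Subgroup (Equiv.Perm (Σ v, 𝒢.X v)) :=
  (Subgroup.pi Set.univ 𝒢.G).map (Equiv.Perm.sigmaCongrRightHom 𝒢.X)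

theorem mem_totalGroup {g : Equiv.Perm (Σ v, 𝒢.X v)} :
    g ∈ 𝒢.totalGroup ↔ ∃ γ : ∀ v, Equiv.Perm (𝒢.X v), (∀ v, γ v ∈ 𝒢.G v) ∧
      ∀ v z, g ⟨v, z⟩ = ⟨v, γ v z⟩ := by
  constructor
  · rintro ⟨γ, h, rfl⟩
    exact ⟨γ, fun v => h v trivial, fun _ _ => rfl⟩
  · rintro ⟨γ, h, hg⟩
    exact ⟨γ, fun v _ => h v, Equiv.ext fun ⟨v, z⟩ => (hg v z).symm⟩

theorem exists_mem_totalGroup {v : 𝒢.base.V} {γ : Equiv.Perm (𝒢.X v)} (hγ : γ ∈ 𝒢.G v) :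
    ∃ g ∈ 𝒢.totalGroup, ∀ z, g ⟨v, z⟩ = ⟨v, γ z⟩ := by
  classical
  refine ⟨Equiv.Perm.sigmaCongrRightHom 𝒢.X (Pi.mulSingle v γ),
    ⟨Pi.mulSingle v γ, fun w _ => ?_, rfl⟩, fun z => ?_⟩
  · by_cases h : w = v
    · subst h; simpa using hγ
    · rw [Pi.mulSingle_eq_of_ne h]; exact one_mem (𝒢.G w)
  · simp

variable {𝒢}

theorem fst_of_mem_totalGroup {g : Equiv.Perm (Σ v, 𝒢.X v)} (hg : g ∈ 𝒢.totalGroup)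
    (z : Σ v, 𝒢.X v) : (g z).1 = z.1 := by
  obtain ⟨γ, -, h⟩ := 𝒢.mem_totalGroup.1 hg
  rw [show z = ⟨z.1, z.2⟩ from rfl, h]

variable (𝒢)

/-- The map `Φ_d`, with values in the disjoint union of the sets `X(v)`. -/
def embed (d : 𝒢.base.A) {e : 𝒢.base.Edge} (h : 𝒢.base.edge d = e) (y : 𝒢.Y e) : Σ v, 𝒢.X v :=
  ⟨𝒢.base.t d, 𝒢.Φ d (h ▸ y)⟩

variable {𝒢}

theorem embed_congr {c d : 𝒢.base.A} (hcd : c = d) {e : 𝒢.base.Edge} (hc : 𝒢.base.edge c = e)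
    (hd : 𝒢.base.edge d = e) (y : 𝒢.Y e) : 𝒢.embed c hc y = 𝒢.embed d hd y := by
  subst hcd; rfl

theorem embed_injective (d : 𝒢.base.A) {e : 𝒢.base.Edge} (h : 𝒢.base.edge d = e) :
    Function.Injective (𝒢.embed d h) := by
  subst h
  exact fun y z hyz => (𝒢.embedding d).injective (by simpa [embed] using hyz)

theorem exists_embed_eq (d : 𝒢.base.A) {e : 𝒢.base.Edge} (he : 𝒢.base.edge d = e)
    {h : Equiv.Perm (𝒢.Y e)} (hh : h ∈ 𝒢.H e) :
    ∃ g ∈ 𝒢.totalGroup, ∀ y, g (𝒢.embed d he y) = 𝒢.embed d he (h y) := by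
  subst he
  obtain ⟨γ, hγ, h1⟩ := (𝒢.embedding d).exists_of_mem h hh
  obtain ⟨g, hg, h2⟩ := 𝒢.exists_mem_totalGroup hγ
  exact ⟨g, hg, fun y => (h2 _).trans (by rw [h1]; rfl)⟩

theorem exists_perm_of_stabilizes (d : 𝒢.base.A) {g : Equiv.Perm (Σ v, 𝒢.X v)}
    (hg : g ∈ 𝒢.totalGroup)
    (hs : g '' Set.range (𝒢.embed d rfl) = Set.range (𝒢.embed d rfl)) :
    ∃ h ∈ 𝒢.H (𝒢.base.edge d), ∀ y, g (𝒢.embed d rfl y) = 𝒢.embed d rfl (h y) := by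
  obtain ⟨γ, hγ, h1⟩ := 𝒢.mem_totalGroup.1 hg
  have e : Set.range (𝒢.embed d rfl) = Sigma.mk (𝒢.base.t d) '' Set.range (𝒢.Φ d) := by
    rw [← Set.range_comp]; rfl
  have hs' : γ (𝒢.base.t d) '' Set.range (𝒢.Φ d) = Set.range (𝒢.Φ d) := by
    apply Set.image_injective.2 (sigma_mk_injective (i := 𝒢.base.t d))
    rw [← e, ← hs, e, Set.image_image, Set.image_image]
    exact Set.image_congr fun z _ => (h1 _ z).symm
  obtain ⟨h, hh, h2⟩ := (𝒢.embedding d).exists_of_stabilizes _ (hγ _) hs'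
  exact ⟨h, hh, fun y => (h1 _ _).trans (congrArg (Sigma.mk _) (h2 y))⟩

variable (𝒢)

/-- The permutations of `Y(c)` by which the adhesion maps at `c` and at its reverse may differ. -/
def IsTwist (c : 𝒢.base.A) (ω : Equiv.Perm (𝒢.Y (𝒢.base.edge c))) : Prop :=
  (𝒢.base.rev c ≠ c ∧ ω = 1) ∨
    ∃ hc : 𝒢.base.rev c = c, ω = 𝒢.agent c hc ∨ ω = (𝒢.agent c hc)⁻¹

variable {𝒢}

/-- Twists lie in the normaliser of `H` and, at a given edge, in a single coset of `H`: for
self-reverse `c`, the agent and its inverse differ by the square of the agent. -/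
theorem IsTwist.mul_mul_inv_mem {c : 𝒢.base.A} {ω ω' h : Equiv.Perm (𝒢.Y (𝒢.base.edge c))}
    (hω : 𝒢.IsTwist c ω) (hω' : 𝒢.IsTwist c ω') (hh : h ∈ 𝒢.H (𝒢.base.edge c)) :
    ω' * h * ω⁻¹ ∈ 𝒢.H (𝒢.base.edge c) := by
  rcases hω with ⟨hc, rfl⟩ | ⟨hc, hω⟩
  · rcases hω' with ⟨-, rfl⟩ | ⟨hc', -⟩
    · simpa using hh
    · exact absurd hc' hc
  · rcases hω' with ⟨hc', -⟩ | ⟨_, hω'⟩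
    · exact absurd hc hc'
    set α := 𝒢.agent c hc
    have hconj := 𝒢.agent_conj c hc
    have hsq : α * α ∈ 𝒢.H (𝒢.base.edge c) := by
      have := 𝒢.agent_sq c hc
      rwa [pow_two] at this
    have c1 : ∀ k ∈ 𝒢.H (𝒢.base.edge c), α * k * α⁻¹ ∈ 𝒢.H (𝒢.base.edge c) := fun k hk => by
      rw [← hconj]
      exact ⟨k, hk, rfl⟩
    have c2 : ∀ k ∈ 𝒢.H (𝒢.base.edge c), α⁻¹ * k * α ∈ 𝒢.H (𝒢.base.edge c) := fun k hk => by
      rw [← hconj] at hk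
      obtain ⟨l, hl, rfl⟩ := hk
      simpa [MulAut.conj_apply, mul_assoc, α] using hl
    rcases hω with hω | hω <;> rcases hω' with hω' | hω' <;> rw [hω, hω']
    · exact c1 h hh
    · have := mul_mem (inv_mem hsq) (c1 h hh)
      convert this using 1; group
    · have := mul_mem (c1 h hh) hsq
      convert this using 1; group
    · have := c2 h hh
      convert this using 1; group

/-! ### Parametrised arc bundles and their adhesion sets. -/

namespace Scaffolding

theorem IsAdhesionMap.exists_eq_embed (S : 𝒢.Scaffolding) {a : S.tree.A}
    (h : 𝒢.IsAdhesionMap (S.π.onA a) (S.Ψ a)) {d : 𝒢.base.A} (hd : S.π.onA a = d)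
    {e : 𝒢.base.Edge} (he : 𝒢.base.edge d = e) :
    ∃ γ ∈ 𝒢.totalGroup, ∀ b, S.bunA b = a → ∀ y, S.pA b = ⟨e, y⟩ →
      S.pV (S.graph.t b) = γ (𝒢.embed d he y) := by
  subst hd he
  obtain ⟨γ, hγ, h1⟩ := h
  obtain ⟨g, hg, h2⟩ := 𝒢.exists_mem_totalGroup hγ
  exact ⟨g, hg, fun b hb y hy => (S.Ψ_spec a b hb y hy).trans (by rw [h1]; exact (h2 _).symm)⟩

theorem IsTwistedAdhesionMap.exists_eq_embed (S : 𝒢.Scaffolding) {a : S.tree.A}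
    (h : 𝒢.IsTwistedAdhesionMap (S.π.onA a) (S.Ψ a)) {d : 𝒢.base.A} (hd : S.π.onA a = d)
    (hrev : 𝒢.base.rev d = d) :
    ∃ γ ∈ 𝒢.totalGroup, ∀ b, S.bunA b = a → ∀ y, S.pA b = ⟨𝒢.base.edge d, y⟩ →
      S.pV (S.graph.t b) = γ (𝒢.embed d rfl (𝒢.agent d hrev y)) := by
  subst hd
  obtain ⟨_, γ, hγ, h1⟩ := h
  obtain ⟨g, hg, h2⟩ := 𝒢.exists_mem_totalGroup hγ
  exact ⟨g, hg, fun b hb y hy => (S.Ψ_spec a b hb y hy).trans (by rw [h1]; exact (h2 _).symm)⟩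

/-- `β` parametrises the arc bundle `a`, and the colours of the termini and origins of its arcs are
given by adhesion maps, up to a twist. -/
structure IsParam (S : 𝒢.Scaffolding) (a : S.tree.A) (c : 𝒢.base.A)
    (β : 𝒢.Y (𝒢.base.edge c) → S.graph.A) (γ δ : Equiv.Perm (Σ v, 𝒢.X v))
    (ω : Equiv.Perm (𝒢.Y (𝒢.base.edge c))) : Prop where
  bunA : ∀ y, S.bunA (β y) = a
  surj : ∀ b, S.bunA b = a → ∃ y, β y = b
  memγ : γ ∈ 𝒢.totalGroup
  memδ : δ ∈ 𝒢.totalGroup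
  twist : 𝒢.IsTwist c ω
  t_eq : ∀ y, S.pV (S.graph.t (β y)) = γ (𝒢.embed c rfl y)
  o_eq : ∀ y, S.pV (S.graph.o (β y)) = δ (𝒢.embed (𝒢.base.rev c) (𝒢.base.edge_rev c) (ω y))

theorem exists_isParam (S : 𝒢.Scaffolding) (a : S.tree.A) {c : 𝒢.base.A} (hc : S.π.onA a = c) :
    ∃ β γ δ ω, S.IsParam a c β γ δ ω := by
  have hβ : ∀ y : 𝒢.Y (𝒢.base.edge c), ∃ b, S.bunA b = a ∧ S.pA b = ⟨𝒢.base.edge c, y⟩ := by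
    subst hc
    intro y
    obtain ⟨b, hb, h⟩ := (S.pA_bijOn a).surjOn (Set.mem_range_self y)
    exact ⟨b, hb, h⟩
  choose β hβa hβp using hβ
  have hsurj : ∀ b, S.bunA b = a → ∃ y, β y = b := by
    subst hc
    intro b hb
    obtain ⟨y, hy⟩ := (S.pA_bijOn a).mapsTo hb
    exact ⟨y, (S.pA_bijOn a).injOn (hβa y) hb ((hβp y).trans hy)⟩
  have hrevA : ∀ y, S.bunA (S.graph.rev (β y)) = S.tree.rev a := fun y => by
    conv_rhs => rw [← hβa y]
    rfl
  have hrevp : ∀ y, S.pA (S.graph.rev (β y)) = ⟨𝒢.base.edge c, y⟩ := fun y =>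
    (S.pA_rev _).trans (hβp y)
  have hπ : S.π.onA (S.tree.rev a) = 𝒢.base.rev c := by rw [S.π.map_rev, hc]
  by_cases hr : 𝒢.base.rev c = c
  · have hπ' := hπ.trans hr
    rcases S.adhesion_of_selfReverse a (by rw [hc, hr]) with ⟨h1, h2⟩ | ⟨h1, h2⟩
    · obtain ⟨γ, hγ, hγ'⟩ := IsAdhesionMap.exists_eq_embed S h1 hc rfl
      obtain ⟨δ, hδ, hδ'⟩ := IsTwistedAdhesionMap.exists_eq_embed S h2 hπ' hr
      refine ⟨β, γ, δ, 𝒢.agent c hr, hβa, hsurj, hγ, hδ, Or.inr ⟨hr, Or.inl rfl⟩,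
        fun y => hγ' _ (hβa y) y (hβp y), fun y => ?_⟩
      rw [S.graph.o_eq, embed_congr hr _ rfl]
      exact hδ' _ (hrevA y) y (hrevp y)
    · obtain ⟨γ, hγ, hγ'⟩ := IsTwistedAdhesionMap.exists_eq_embed S h1 hc hr
      obtain ⟨δ, hδ, hδ'⟩ := IsAdhesionMap.exists_eq_embed S h2 hπ' rfl
      -- Here the twist sits at the terminus. Reparametrising by the inverse agent moves it to the
      -- origin, as its inverse.
      refine ⟨fun y => β ((𝒢.agent c hr)⁻¹ y), γ, δ, (𝒢.agent c hr)⁻¹, fun y => hβa _,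
        fun b hb => ?_, hγ, hδ, Or.inr ⟨hr, Or.inr rfl⟩, fun y => ?_, fun y => ?_⟩
      · obtain ⟨y, hy⟩ := hsurj b hb
        exact ⟨𝒢.agent c hr y, by simpa using hy⟩
      · have := hγ' _ (hβa _) _ (hβp ((𝒢.agent c hr)⁻¹ y))
        simpa using this
      · rw [S.graph.o_eq, embed_congr hr _ rfl]
        exact hδ' _ (hrevA _) _ (hrevp _)
  · obtain ⟨γ, hγ, hγ'⟩ := IsAdhesionMap.exists_eq_embed S (S.adhesion a (by rwa [hc])) hc rfl
    obtain ⟨δ, hδ, hδ'⟩ := IsAdhesionMap.exists_eq_embed S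
      (S.adhesion (S.tree.rev a) (by
        rw [hπ, 𝒢.base.rev_rev]; exact fun h => hr h.symm)) hπ (𝒢.base.edge_rev c)
    refine ⟨β, γ, δ, 1, hβa, hsurj, hγ, hδ, Or.inl ⟨hr, rfl⟩,
      fun y => hγ' _ (hβa y) y (hβp y), fun y => ?_⟩
    rw [S.graph.o_eq]
    exact hδ' _ (hrevA y) y (hrevp y)

/-- The set of colours of the termini of the arcs in the bundle `a`. -/
def adhesionColours (S : 𝒢.Scaffolding) (a : S.tree.A) : Set (Σ v, 𝒢.X v) :=
  {z | ∃ b, S.bunA b = a ∧ S.pV (S.graph.t b) = z}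

theorem IsParam.adhesionColours_eq {S : 𝒢.Scaffolding} {a : S.tree.A} {c : 𝒢.base.A}
    {β : 𝒢.Y (𝒢.base.edge c) → S.graph.A} {γ δ : Equiv.Perm (Σ v, 𝒢.X v)}
    {ω : Equiv.Perm (𝒢.Y (𝒢.base.edge c))} (h : S.IsParam a c β γ δ ω) :
    S.adhesionColours a = γ '' Set.range (𝒢.embed c rfl) := by
  ext z
  constructor
  · rintro ⟨b, hb, rfl⟩
    obtain ⟨y, rfl⟩ := h.surj b hb
    exact ⟨_, ⟨y, rfl⟩, (h.t_eq y).symm⟩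
  · rintro ⟨_, ⟨y, rfl⟩, rfl⟩
    exact ⟨β y, h.bunA y, h.t_eq y⟩

theorem adhesionColours_eq_range (S : 𝒢.Scaffolding) (a : S.tree.A) :
    S.adhesionColours a = Sigma.mk _ '' Set.range (S.Ψ a) := by
  ext z
  constructor
  · rintro ⟨b, hb, rfl⟩
    obtain ⟨y, hy⟩ := (S.pA_bijOn a).mapsTo hb
    exact ⟨_, ⟨y, rfl⟩, (S.Ψ_spec a b hb y hy.symm).symm⟩
  · rintro ⟨_, ⟨y, rfl⟩, rfl⟩
    obtain ⟨b, hb, h⟩ := (S.pA_bijOn a).surjOn (Set.mem_range_self y)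
    exact ⟨b, hb, S.Ψ_spec a b hb y h⟩

theorem existsUnique_arc_of_colours (S : 𝒢.Scaffolding) (v : S.tree.V) (c : 𝒢.base.A)
    (hc : 𝒢.base.t c = S.π.onV v) {g : Equiv.Perm (Σ v, 𝒢.X v)} (hg : g ∈ 𝒢.totalGroup) :
    ∃! a, S.π.onA a = c ∧ S.tree.t a = v ∧
      S.adhesionColours a = g '' Set.range (𝒢.embed c rfl) := by
  obtain ⟨γ, hγ, h⟩ := 𝒢.mem_totalGroup.1 hg
  have e : g '' Set.range (𝒢.embed c rfl)
      = Sigma.mk _ '' (γ (𝒢.base.t c) '' Set.range (𝒢.Φ c)) := by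
    rw [← Set.range_comp, ← Set.range_comp, ← Set.range_comp]
    exact congrArg Set.range (funext fun y => h _ _)
  simp only [adhesionColours_eq_range, e]
  exact S.existsUnique_arc v c hc _ ⟨_, hγ _, rfl⟩

/-- This is the uniqueness half of axiom (3). -/
theorem arc_eq_of_colours (S : 𝒢.Scaffolding) {a b : S.tree.A} (hπ : S.π.onA a = S.π.onA b)
    (ht : S.tree.t a = S.tree.t b) (h : S.adhesionColours a = S.adhesionColours b) : a = b := by
  obtain ⟨β, γ, δ, ω, hb⟩ := S.exists_isParam b rfl
  refine (S.existsUnique_arc_of_colours (S.tree.t b) (S.π.onA b) (S.π.map_t b).symm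
    hb.memγ).unique ⟨hπ, ht, h.trans hb.adhesionColours_eq⟩ ⟨rfl, rfl, hb.adhesionColours_eq⟩

/-- This is the existence half of axiom (3): elements of `G` permute the adhesion sets. -/
theorem exists_arc_of_image (S S' : 𝒢.Scaffolding) (v : S.tree.V) (v' : S'.tree.V)
    (hv : S.π.onV v = S'.π.onV v') {g : Equiv.Perm (Σ v, 𝒢.X v)} (hg : g ∈ 𝒢.totalGroup)
    (a : S.tree.A) (ha : S.tree.t a = v) : ∃ a', S'.π.onA a' = S.π.onA a ∧ S'.tree.t a' = v' ∧
      S'.adhesionColours a' = g '' S.adhesionColours a := by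
  obtain ⟨β, γ, δ, ω, h⟩ := S.exists_isParam a rfl
  obtain ⟨a', ha', -⟩ := S'.existsUnique_arc_of_colours v' (S.π.onA a)
    (by rw [← S.π.map_t, ha, hv]) (mul_mem hg h.memγ)
  refine ⟨a', ha'.1, ha'.2.1, ha'.2.2.trans ?_⟩
  rw [h.adhesionColours_eq, Set.image_image]
  rfl

theorem exists_arc_over (S : 𝒢.Scaffolding) (v : S.tree.V) (c : 𝒢.base.A)
    (hc : 𝒢.base.t c = S.π.onV v) : ∃ a, S.π.onA a = c ∧ S.tree.t a = v := by
  obtain ⟨a, ha, -⟩ := S.existsUnique_arc_of_colours v c hc (one_mem _)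
  exact ⟨a, ha.1, ha.2.1⟩

/-- Every arc of `Δ` has an adhesion set, so by axiom (3) paths of the connected graph `Δ` lift to
`T_Σ`. -/
theorem exists_vertex_over (S : 𝒢.Scaffolding) (u : 𝒢.base.V) : ∃ v, S.π.onV v = u := by
  obtain ⟨v₀⟩ := S.isTree.2.connected.nonempty
  obtain ⟨w₀, hw, ⟨q⟩⟩ : ∃ w₀, (∃ v, S.π.onV v = w₀) ∧ 𝒢.base.underlying.Reachable u w₀ :=
    ⟨_, ⟨v₀, rfl⟩, 𝒢.connected.preconnected u (S.π.onV v₀)⟩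
  induction q with
  | nil => exact hw
  | cons h q ih =>
    obtain ⟨v, hv⟩ := ih hw
    obtain ⟨-, c, rfl, hc⟩ := h
    obtain ⟨a, ha, -⟩ := S.exists_arc_over v c (hc.trans hv.symm)
    exact ⟨S.tree.o a, by rw [S.π.map_o, ha]⟩

/-- Arcs with the same ends lie in one bundle, where the injective adhesion map recovers the arc
from the colour of its terminus. -/
theorem graph_injective (S : 𝒢.Scaffolding) :
    Function.Injective fun a => (S.graph.o a, S.graph.t a) := by
  intro a b hab
  obtain ⟨ho, ht⟩ := Prod.ext_iff.1 hab
  dsimp at ho ht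
  have h : S.bunA a = S.bunA b := Quotient.sound
    ⟨by rw [ho], by rw [ht]⟩
  obtain ⟨β, γ, δ, ω, hp⟩ := S.exists_isParam (S.bunA b) rfl
  obtain ⟨y, rfl⟩ := hp.surj a h
  obtain ⟨z, hz⟩ := hp.surj b rfl
  have := congrArg S.pV ht
  rw [← hz, hp.t_eq, hp.t_eq] at this
  rw [← hz, embed_injective _ _ (γ.injective this)]

/-! ### Continuing a local map across a tree arc. -/

/-- The permutations `g` and `k` of the colours match the arcs in the bundle `a` with the arcs in
the bundle `a'`, via their termini and via their origins. -/
structure Matches (S S' : 𝒢.Scaffolding) (a : S.tree.A) (a' : S'.tree.A)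
    (g k : Equiv.Perm (Σ v, 𝒢.X v)) : Prop where
  π_eq : S'.π.onA a' = S.π.onA a
  forth : ∀ b, S.bunA b = a → ∃ b', S'.bunA b' = a' ∧
    S'.pV (S'.graph.t b') = g (S.pV (S.graph.t b)) ∧ S'.pV (S'.graph.o b') = k (S.pV (S.graph.o b))
  back : ∀ b', S'.bunA b' = a' → ∃ b, S.bunA b = a ∧
    S'.pV (S'.graph.t b') = g (S.pV (S.graph.t b)) ∧ S'.pV (S'.graph.o b') = k (S.pV (S.graph.o b))

theorem bunA_rev (S : 𝒢.Scaffolding) {b : S.graph.A} {a : S.tree.A}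
    (h : S.bunA b = S.tree.rev a) : S.bunA (S.graph.rev b) = a := by
  rw [← S.tree.rev_rev a, ← h]; rfl

theorem Matches.rev {S S' : 𝒢.Scaffolding} {a : S.tree.A} {a' : S'.tree.A}
    {g k : Equiv.Perm (Σ v, 𝒢.X v)} (h : Matches S S' a a' g k) :
    Matches S S' (S.tree.rev a) (S'.tree.rev a') k g where
  π_eq := by rw [S.π.map_rev, S'.π.map_rev, h.π_eq]
  forth b hb := by
    obtain ⟨b', h1, h2, h3⟩ := h.forth (S.graph.rev b) (S.bunA_rev hb)
    rw [← S.graph.o_eq] at h2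
    rw [← S.graph.t_eq] at h3
    exact ⟨S'.graph.rev b', S'.bunA_rev (by rw [S'.tree.rev_rev, h1]),
      by rw [← S'.graph.o_eq, h3], by rw [← S'.graph.t_eq, h2]⟩
  back b' hb' := by
    obtain ⟨b, h1, h2, h3⟩ := h.back (S'.graph.rev b') (S'.bunA_rev hb')
    rw [← S'.graph.o_eq] at h2
    rw [← S'.graph.t_eq] at h3
    exact ⟨S.graph.rev b, S.bunA_rev (by rw [S.tree.rev_rev, h1]),
      by rw [← S.graph.o_eq, h3], by rw [← S.graph.t_eq, h2]⟩

theorem Matches.adhesionColours_eq {S S' : 𝒢.Scaffolding} {a : S.tree.A} {a' : S'.tree.A}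
    {g k : Equiv.Perm (Σ v, 𝒢.X v)} (h : Matches S S' a a' g k) :
    S'.adhesionColours a' = g '' S.adhesionColours a := by
  ext z
  constructor
  · rintro ⟨b', hb', rfl⟩
    obtain ⟨b, h1, h2, -⟩ := h.back b' hb'
    exact ⟨_, ⟨b, h1, rfl⟩, h2.symm⟩
  · rintro ⟨_, ⟨b, hb, rfl⟩, rfl⟩
    obtain ⟨b', h1, h2, -⟩ := h.forth b hb
    exact ⟨b', h1, h2⟩

theorem exists_matches {S S' : 𝒢.Scaffolding} {a : S.tree.A} {a' : S'.tree.A}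
    (hπ : S'.π.onA a' = S.π.onA a) {g : Equiv.Perm (Σ v, 𝒢.X v)} (hg : g ∈ 𝒢.totalGroup)
    (h : S'.adhesionColours a' = g '' S.adhesionColours a) :
    ∃ k ∈ 𝒢.totalGroup, Matches S S' a a' g k := by
  obtain ⟨β, γ, δ, ω, hp⟩ := S.exists_isParam a rfl
  obtain ⟨β', γ', δ', ω', hp'⟩ := S'.exists_isParam a' hπ
  -- As `g` maps one adhesion set onto the other, `γ'⁻¹ g γ` stabilises the image of `Φ` and induces
  -- some `n` in `H`.
  obtain ⟨n, hn, hn'⟩ := exists_perm_of_stabilizes (S.π.onA a)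
    (mul_mem (inv_mem hp'.memγ) (mul_mem hg hp.memγ)) (by
      rw [hp.adhesionColours_eq, hp'.adhesionColours_eq] at h
      have := congrArg (fun s => (γ'⁻¹ : Equiv.Perm _) '' s) h
      simp only [Set.image_image] at this
      refine this.symm.trans ?_
      simp)
  -- Seen from the origins, `n` becomes `ω' n ω⁻¹`, which is again in `H` and so extends to some
  -- `m`; the continuation is `δ' m δ⁻¹`.
  obtain ⟨m, hm, hm'⟩ := exists_embed_eq (𝒢.base.rev (S.π.onA a)) (𝒢.base.edge_rev _)
    (hp.twist.mul_mul_inv_mem hp'.twist hn)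
  have key : ∀ y, S'.pV (S'.graph.t (β' (n y))) = g (S.pV (S.graph.t (β y))) ∧
      S'.pV (S'.graph.o (β' (n y))) = (δ' * m * δ⁻¹) (S.pV (S.graph.o (β y))) := by
    intro y
    constructor
    · rw [hp'.t_eq, hp.t_eq, ← hn']
      simp
    · rw [hp'.o_eq, hp.o_eq]
      simp [hm']
  refine ⟨δ' * m * δ⁻¹, mul_mem (mul_mem hp'.memδ hm) (inv_mem hp.memδ), hπ, fun b hb => ?_,
    fun b' hb' => ?_⟩
  · obtain ⟨y, rfl⟩ := hp.surj b hb
    exact ⟨β' (n y), hp'.bunA _, key y⟩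
  · obtain ⟨y, rfl⟩ := hp'.surj b' hb'
    refine ⟨β (n⁻¹ y), hp.bunA _, ?_⟩
    have := key (n⁻¹ y)
    simpa using this

theorem exists_arc_of_adj (S : 𝒢.Scaffolding) {v w : S.tree.V} (h : S.tree.underlying.Adj v w) :
    ∃ a, S.tree.t a = v ∧ S.tree.o a = w := by
  obtain ⟨-, a, ho, ht⟩ := h
  exact ⟨S.tree.rev a, by rw [← S.tree.o_eq, ho], by rw [← S.tree.t_eq, ht]⟩

theorem adj_of_arc (S : 𝒢.Scaffolding) (a : S.tree.A) :
    S.tree.underlying.Adj (S.tree.t a) (S.tree.o a) :=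
  ⟨(S.isTree.1.1 a).symm, S.tree.rev a, (S.tree.t_eq a).symm, (S.tree.o_eq a).symm⟩

theorem tree_arc_ext (S : 𝒢.Scaffolding) {a b : S.tree.A} (ht : S.tree.t a = S.tree.t b)
    (ho : S.tree.o a = S.tree.o b) : a = b :=
  S.isTree.1.2 (Prod.ext ho ht)

/-! ### The bijection of the quotient trees. -/

/-- There is a bijection between the vertices of the trees, together with local maps, that respects
the adhesion sets. -/
theorem exists_tree_bijection (S S' : 𝒢.Scaffolding) :
    ∃ (f : S.tree.V → S'.tree.V) (g : S.tree.V → Equiv.Perm (Σ v, 𝒢.X v)),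
      f.Bijective ∧ (∀ v, S'.π.onV (f v) = S.π.onV v) ∧ (∀ v, g v ∈ 𝒢.totalGroup) ∧
      (∀ a, ∃ a', S'.tree.t a' = f (S.tree.t a) ∧ S'.tree.o a' = f (S.tree.o a) ∧
        Matches S S' a a' (g (S.tree.t a)) (g (S.tree.o a))) ∧
      ∀ a', ∃ a, S'.tree.t a' = f (S.tree.t a) ∧ S'.tree.o a' = f (S.tree.o a) ∧
        Matches S S' a a' (g (S.tree.t a)) (g (S.tree.o a)) := by
  obtain ⟨r⟩ := S.isTree.2.connected.nonempty
  obtain ⟨r', hr'⟩ := S'.exists_vertex_over (S.π.onV r)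
  obtain ⟨s, -, hP, hC⟩ := S.isTree.2.exists_section
    (α := S'.tree.V × Equiv.Perm (Σ v, 𝒢.X v))
    (fun v s => S'.π.onV s.1 = S.π.onV v ∧ s.2 ∈ 𝒢.totalGroup)
    (fun v w s s' => ∃ a a', S.tree.t a = v ∧ S.tree.o a = w ∧ S'.tree.t a' = s.1 ∧
      S'.tree.o a' = s'.1 ∧ Matches S S' a a' s.2 s'.2)
    (fun v w s s' ⟨a, a', h1, h2, h3, h4, h5⟩ => ⟨S.tree.rev a, S'.tree.rev a',
      by rw [← S.tree.o_eq, h2], by rw [← S.tree.t_eq, h1], by rw [← S'.tree.o_eq, h4],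
      by rw [← S'.tree.t_eq, h3], h5.rev⟩)
    (fun v w s h hs => by
      obtain ⟨a, hv, hw⟩ := S.exists_arc_of_adj h
      obtain ⟨a', h1, h2, h3⟩ := exists_arc_of_image S S' v s.1 hs.1.symm hs.2 a hv
      obtain ⟨k, hk, hm⟩ := exists_matches h1 hs.2 h3
      exact ⟨(S'.tree.o a', k), ⟨by rw [S'.π.map_o, h1, ← S.π.map_o, hw], hk⟩,
        a, a', hv, hw, h2, rfl, hm⟩)
    r (r', 1) ⟨hr', one_mem _⟩
  have harc : ∀ a, ∃ a', S'.tree.t a' = (s (S.tree.t a)).1 ∧ S'.tree.o a' = (s (S.tree.o a)).1 ∧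
      Matches S S' a a' (s (S.tree.t a)).2 (s (S.tree.o a)).2 := by
    intro a
    obtain ⟨b, a', h1, h2, h3, h4, h5⟩ := hC _ _ (S.adj_of_arc a)
    obtain rfl := S.tree_arc_ext h1 h2
    exact ⟨a', h3, h4, h5⟩
  have hback : ∀ v a', S'.tree.t a' = (s v).1 → ∃ a, S.tree.t a = v ∧
      S'.tree.o a' = (s (S.tree.o a)).1 ∧ Matches S S' a a' (s v).2 (s (S.tree.o a)).2 := by
    intro v a' ha'
    obtain ⟨a, h1, rfl, h3⟩ := exists_arc_of_image S' S _ v (hP v).1 (inv_mem (hP v).2) a' ha'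
    obtain ⟨b', hb1, hb2, hb3⟩ := harc a
    -- The arc `a` was found by pulling the adhesion set of `a'` back along `g`; its partner `b'`
    -- has the same adhesion set as `a'`.
    obtain rfl : b' = a' := by
      refine S'.arc_eq_of_colours (hb3.π_eq.trans h1) (hb1.trans ha'.symm) ?_
      rw [hb3.adhesionColours_eq, h3, Set.image_image]
      simp
    exact ⟨a, rfl, hb2, hb3⟩
  have hbij : Function.Bijective fun v => (s v).1 := ?_
  · refine ⟨fun v => (s v).1, fun v => (s v).2, hbij, fun v => (hP v).1, fun v => (hP v).2, harc,
      fun a' => ?_⟩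
    obtain ⟨v, hv⟩ := hbij.2 (S'.tree.t a')
    obtain ⟨a, rfl, h2, h3⟩ := hback v a' hv.symm
    exact ⟨a, hv.symm, h2, h3⟩
  refine S.isTree.2.bijective_of_local S'.isTree.2 _ (fun v w h => ?_) (fun v w₁ w₂ h₁ h₂ h => ?_)
    fun v w' h => ?_
  · obtain ⟨a, rfl, rfl⟩ := S.exists_arc_of_adj h
    obtain ⟨a', h1, h2, -⟩ := harc a
    rw [← h1, ← h2]
    exact S'.adj_of_arc a'
  · obtain ⟨a, rfl, rfl⟩ := S.exists_arc_of_adj h₁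
    obtain ⟨b, hb, rfl⟩ := S.exists_arc_of_adj h₂
    obtain ⟨a', ha1, ha2, ha3⟩ := harc a
    obtain ⟨b', hb1, hb2, hb3⟩ := harc b
    -- Equal images of two neighbours force equal tree arcs, hence equal `g`-images of the adhesion
    -- sets of `a` and `b`, so these sets agree.
    obtain rfl : a' = b' := S'.tree_arc_ext (by rw [ha1, hb1, hb]) (by rw [ha2, hb2]; exact h)
    rw [S.arc_eq_of_colours (ha3.π_eq.symm.trans hb3.π_eq) hb.symm]
    have e := ha3.adhesionColours_eq.symm.trans hb3.adhesionColours_eq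
    rw [hb] at e
    exact Set.image_injective.2 (Equiv.injective _) e
  · obtain ⟨a', ha', rfl⟩ := S'.exists_arc_of_adj h
    obtain ⟨a, rfl, h2, -⟩ := hback v a' ha'
    exact ⟨S.tree.o a, S.adj_of_arc a, h2.symm⟩

/-! ### Gluing the local maps to an acceptable isomorphism. -/

theorem pV_mem (S : 𝒢.Scaffolding) (x : S.graph.V) : (S.pV x).1 = S.π.onV (S.bunV x) := by
  obtain ⟨z, hz⟩ := Iso.exists_pV S (x := x) rfl
  rw [hz]

theorem exists_of_pV (S : 𝒢.Scaffolding) (v : S.tree.V) (z : Σ v, 𝒢.X v)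
    (hz : z.1 = S.π.onV v) : ∃ x, S.bunV x = v ∧ S.pV x = z := by
  obtain ⟨w, z⟩ := z
  dsimp at hz
  subst hz
  obtain ⟨x, hx, h⟩ := (S.pV_bijOn v).surjOn (Set.mem_range_self z)
  exact ⟨x, hx, h⟩

theorem vertex_ext (S : 𝒢.Scaffolding) {x y : S.graph.V} (hb : S.bunV x = S.bunV y)
    (hp : S.pV x = S.pV y) : x = y :=
  (S.pV_bijOn (S.bunV y)).injOn hb rfl hp

theorem exists_isAcceptable (S S' : 𝒢.Scaffolding) : ∃ F : S.Iso S', F.IsAcceptable := by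
  obtain ⟨f, g, hf, hπ, hg, harc, hback⟩ := exists_tree_bijection S S'
  -- The bundle and the colour of the image are prescribed, and together they determine a vertex.
  have hF : ∀ x, ∃ x', S'.bunV x' = f (S.bunV x) ∧ S'.pV x' = g (S.bunV x) (S.pV x) := fun x =>
    S'.exists_of_pV _ _ (by rw [fst_of_mem_totalGroup (hg _), pV_mem, hπ])
  choose F hFb hFp using hF
  have hbij : F.Bijective := by
    constructor
    · intro x y h
      have hb : S.bunV x = S.bunV y := hf.1 (by rw [← hFb, ← hFb, h])
      refine S.vertex_ext hb ((g (S.bunV y)).injective ?_)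
      rw [← hFp, ← h, hFp, hb]
    · intro x'
      obtain ⟨v, hv⟩ := hf.2 (S'.bunV x')
      obtain ⟨x, rfl, hx⟩ := S.exists_of_pV v ((g v)⁻¹ (S'.pV x'))
        (by rw [fst_of_mem_totalGroup (inv_mem (hg _)), pV_mem, ← hv, hπ])
      refine ⟨x, S'.vertex_ext ((hFb x).trans hv) ?_⟩
      rw [hFp, hx]
      simp
  -- Matched arcs have ends corresponding under `F`, since bundles and colours of the ends agree.
  have hends : ∀ b a' b', S'.bunA b' = a' → S'.tree.t a' = f (S.tree.t (S.bunA b)) →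
      S'.tree.o a' = f (S.tree.o (S.bunA b)) →
      S'.pV (S'.graph.t b') = g (S.tree.t (S.bunA b)) (S.pV (S.graph.t b)) →
      S'.pV (S'.graph.o b') = g (S.tree.o (S.bunA b)) (S.pV (S.graph.o b)) →
      S'.graph.o b' = F (S.graph.o b) ∧ S'.graph.t b' = F (S.graph.t b) := by
    rintro b _ b' rfl ht ho hpt hpo
    exact ⟨S'.vertex_ext (ho.trans (hFb _).symm) (hpo.trans (hFp _).symm),
      S'.vertex_ext (ht.trans (hFb _).symm) (hpt.trans (hFp _).symm)⟩
  obtain ⟨I, hI, hIπ⟩ := SerreGraph.exists_iso S.graph_injective S'.graph_injective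
    (Equiv.ofBijective F hbij) (fun b b' => S.π.onA (S.bunA b) = S'.π.onA (S'.bunA b'))
    (fun b => by
      obtain ⟨a', ht, ho, hm⟩ := harc (S.bunA b)
      obtain ⟨b', hb', h2, h3⟩ := hm.forth b rfl
      obtain ⟨h4, h5⟩ := hends b a' b' hb' ht ho h2 h3
      exact ⟨b', h4, h5, by rw [hb', hm.π_eq]⟩)
    (fun b' => by
      obtain ⟨a, ht, ho, hm⟩ := hback (S'.bunA b')
      obtain ⟨b, rfl, h2, h3⟩ := hm.back b' rfl
      exact ⟨b, hends b _ b' rfl ht ho h2 h3⟩)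
  have hIV : ∀ x, I.onV x = F x := fun x => by rw [hI]; rfl
  refine ⟨{ I with
    rel_iff := fun x y => ?_
    π_onV := fun x => ?_
    π_onA := hIπ }, ?_⟩
  · rw [hIV, hIV]
    refine Quotient.eq.symm.trans (Iff.trans ?_ Quotient.eq)
    change S.bunV x = S.bunV y ↔ S'.bunV (F x) = S'.bunV (F y)
    rw [hFb, hFb, hf.1.eq_iff]
  · rw [hIV, hFb, hπ]
  · intro v
    obtain ⟨γ, hγ, h⟩ := 𝒢.mem_totalGroup.1 (hg v)
    refine ⟨γ _, hγ _, ?_⟩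
    rintro x rfl z hz
    change S'.pV (I.onV x) = _
    rw [hIV, hFp, hz, h]

end Scaffolding

end GraphOfActions

/-! ### Conjugation by the acceptable isomorphism. -/

/-- The universal groups with respect to two scaffoldings are isomorphic, and so are their actions
on (the vertices and the arcs of) the scaffoldings, by conjugation with an acceptable scaffolding
isomorphism. -/
theorem mainTheorem2 (𝒢 : GraphOfActions) (S : 𝒢.Scaffolding) (S' : 𝒢.Scaffolding) :
    ∃ F : S.Iso S', F.IsAcceptable ∧
      ∃ φ : S.universalGroup ≃* S'.universalGroup,
        (∀ g : S.universalGroup, (φ g : S'.Iso S') = F.comp ((g : S.Iso S).comp F.symm)) ∧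
        IsActionIso φ F.onV ∧ IsActionIso φ F.onA := by
  obtain ⟨F, hF⟩ := GraphOfActions.Scaffolding.exists_isAcceptable S S'
  refine ⟨F, hF,
    { toFun := fun g => ⟨F.comp ((g : S.Iso S).comp F.symm), (hF.comp (g.2.comp hF.symm) :)⟩
      invFun := fun g => ⟨F.symm.comp ((g : S'.Iso S').comp F), (hF.symm.comp (g.2.comp hF) :)⟩
      left_inv := fun g => ?_
      right_inv := fun g => ?_
      map_mul' := fun g h => ?_ }, fun g => rfl, fun g x => ?_, fun g a => ?_⟩
  · refine Subtype.ext (GraphOfActions.Scaffolding.Iso.ext ?_ ?_) <;>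
      exact Equiv.ext fun x => by
        simp [GraphOfActions.Scaffolding.Iso.comp, GraphOfActions.Scaffolding.Iso.symm]
  · refine Subtype.ext (GraphOfActions.Scaffolding.Iso.ext ?_ ?_) <;>
      exact Equiv.ext fun x => by
        simp [GraphOfActions.Scaffolding.Iso.comp, GraphOfActions.Scaffolding.Iso.symm]
  · refine Subtype.ext (GraphOfActions.Scaffolding.Iso.ext ?_ ?_)
    · refine Equiv.ext fun x => ?_
      change F.onV (g.1.onV (h.1.onV (F.onV.symm x)))
        = F.onV (g.1.onV (F.onV.symm (F.onV (h.1.onV (F.onV.symm x)))))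
      rw [Equiv.symm_apply_apply]
    · refine Equiv.ext fun x => ?_
      change F.onA (g.1.onA (h.1.onA (F.onA.symm x)))
        = F.onA (g.1.onA (F.onA.symm (F.onA (h.1.onA (F.onA.symm x)))))
      rw [Equiv.symm_apply_apply]
  · exact congrArg (fun y => F.onV (g.1.onV y)) (F.onV.symm_apply_apply x)
  · exact congrArg (fun y => F.onA (g.1.onA y)) (F.onA.symm_apply_apply a)
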